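/- A hook of a partition $\lambda$ is attached to each box of its Young diagram; its length is the number of boxes directly to the right of the box, plus the number of boxes directly below it, plus $1$. A partition is a $t$-core if none of its hooks has length $t$. An $s\ (\mathrm{mod}\ t)$-core is a partition having no hook of length $s, s+t, s+2t, \dots$; let $c_{s(t)}(n)$ denote the number of partitions of $n$ that are $s\ (\mathrm{mod}\ t)$-cores. Thus $c_{4(2)}(n)$ is the number of partitions of $n$ having no hook of even length other than $2$. A partition is a $4\ (\mathrm{mod}\ 2)$-core if and only if it is both a $4$-core and a $6$-core. Moreover, for all integers $j \ge 0$, $$c_{4(2)}(11j+9) = 0 \qquad\text{and}\qquad c_{4(2)}(11j+2) \equiv 0 \pmod 2 .$$ -/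

import Mathlib

/-- The Young diagram of a partition: row `i` (counted from `0`) has as many boxes as the `i`-th
largest part. -/
def Nat.Partition.youngDiagram {n : ℕ} (p : n.Partition) : YoungDiagram :=
  YoungDiagram.ofRowLens (p.parts.sort (· ≥ ·)) (p.parts.pairwise_sort (· ≥ ·)).sortedGE

/-- The hook length of the box in row `i` and column `j` (counted from `0`) of a Young diagram:
the number of boxes directly to its right, plus the number of boxes directly below it, plus `1`.
It is meant for boxes of the diagram only. -/
def YoungDiagram.hookLength (μ : YoungDiagram) (i j : ℕ) : ℕ :=
  (μ.rowLen i - (j + 1)) + (μ.colLen j - (i + 1)) + 1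

/-- The partition `p` has a hook of length `h`. -/
def Nat.Partition.HasHook {n : ℕ} (p : n.Partition) (h : ℕ) : Prop :=
  ∃ i j : ℕ, (i, j) ∈ p.youngDiagram ∧ p.youngDiagram.hookLength i j = h

/-- A `t`-core is a partition without hooks of length `t`. -/
def Nat.Partition.IsCore {n : ℕ} (t : ℕ) (p : n.Partition) : Prop :=
  ¬ p.HasHook t

/-- An `s (mod t)`-core is a partition without hooks of length `s, s + t, s + 2t, …`. -/
def Nat.Partition.IsModCore {n : ℕ} (s t : ℕ) (p : n.Partition) : Prop :=
  ∀ k : ℕ, ¬ p.HasHook (s + k * t)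

/-- `c_{s(t)}(n)`, the number of `s (mod t)`-cores of size `n`. -/
noncomputable def numModCores (s t n : ℕ) : ℕ :=
  Nat.card {p : n.Partition // p.IsModCore s t}

/-! Encode a diagram by its Maya diagram: a hook of length `h` is a bead at `x` with a gap at `x -
h` (`exists_hookLength_eq_iff`). Without even hooks beyond 2, each parity runner is flush except
that its top bead may be raised by one place. Summing bead positions gives `2n = d² - d + 4e`, where
`e ∈ {0, 1, 2}` counts the raised runners (`two_mul_card_of_no_even_hook`), so `8n + 1 - 16e` is a
square. Modulo 11 this is impossible for `n ≡ 9`, and for `n ≡ 2` it forces `e = 1`. Conjugation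
exchanges the runners, so it then has no fixed point and pairs off the cores. -/

namespace YoungDiagram

/-- The Maya diagram of `μ`: the positions of the vertical steps along the boundary of `μ`. -/
def maya (μ : YoungDiagram) : Set ℤ :=
  Set.range fun i : ℕ => (μ.rowLen i : ℤ) - i - 1

theorem lt_rowLen_iff_lt_colLen (μ : YoungDiagram) (i j : ℕ) :
    j < μ.rowLen i ↔ i < μ.colLen j := by
  rw [← mem_iff_lt_rowLen, mem_iff_lt_colLen]

theorem rowLen_eq_zero {μ : YoungDiagram} {i : ℕ} (h : μ.colLen 0 ≤ i) : μ.rowLen i = 0 := by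
  have := μ.lt_rowLen_iff_lt_colLen i 0
  omega

/-- Transposing reverses the boundary path and exchanges its vertical and horizontal steps. -/
theorem mem_maya_transpose (μ : YoungDiagram) (z : ℤ) :
    z ∈ μ.transpose.maya ↔ -1 - z ∉ μ.maya := by
  simp only [maya, Set.mem_range, rowLen_transpose]
  constructor
  · rintro ⟨j, hj⟩ ⟨i, hi⟩
    have := μ.lt_rowLen_iff_lt_colLen i j
    omega
  · intro h
    have hex : ∃ i : ℕ, (μ.rowLen i : ℤ) - i ≤ -1 - z := by
      refine ⟨μ.colLen 0 + z.natAbs + 1, ?_⟩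
      rw [rowLen_eq_zero (by omega)]
      omega
    classical
    -- The first row past position `-1 - z`: the horizontal step there ends a column of length
    -- exactly `i`.
    have hi := Nat.find_spec hex
    have hmin : ∀ k < Nat.find hex, ¬ ((μ.rowLen k : ℤ) - k ≤ -1 - z) :=
      fun k hk => Nat.find_min hex hk
    generalize Nat.find hex = i at hi hmin
    have hj : 0 ≤ -1 - z + i := by omega
    obtain ⟨j, hj⟩ := Int.eq_ofNat_of_zero_le hj
    refine ⟨j, ?_⟩
    have h1 := μ.lt_rowLen_iff_lt_colLen i j
    have hc : μ.colLen j = i := by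
      rcases Nat.eq_zero_or_pos i with rfl | hpos
      · omega
      · obtain ⟨k, rfl⟩ : ∃ k, i = k + 1 := ⟨i - 1, by omega⟩
        have h2 := μ.lt_rowLen_iff_lt_colLen k j
        have h3 := hmin k (by omega)
        have h4 : ¬ ((μ.rowLen k : ℤ) - k - 1 = -1 - z) := fun h' => h ⟨k, h'⟩
        omega
    omega

/-- A hook runs from the vertical step ending its row to the horizontal step ending its column; its
length is their distance. -/
theorem exists_hookLength_eq_iff (μ : YoungDiagram) {h : ℕ} (hh : 0 < h) :
    (∃ i j : ℕ, (i, j) ∈ μ ∧ μ.hookLength i j = h) ↔ ∃ x ∈ μ.maya, x - h ∉ μ.maya := by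
  have key (x : ℤ) : x - h ∉ μ.maya ↔ ∃ j : ℕ, (j : ℤ) - μ.colLen j = x - h := by
    have := μ.mem_maya_transpose (-1 - (x - h))
    rw [show -1 - (-1 - (x - h)) = x - h by ring] at this
    rw [← this]
    simp only [maya, Set.mem_range, rowLen_transpose]
    exact exists_congr fun j => by omega
  constructor
  · rintro ⟨i, j, hm, hl⟩
    have h1 := mem_iff_lt_rowLen.1 hm
    have h2 := mem_iff_lt_colLen.1 hm
    refine ⟨_, ⟨i, rfl⟩, (key _).2 ⟨j, ?_⟩⟩
    unfold hookLength at hl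
    dsimp only
    omega
  · rintro ⟨_, ⟨i, rfl⟩, hx⟩
    obtain ⟨j, hj⟩ := (key _).1 hx
    dsimp only at hj
    have h1 := μ.lt_rowLen_iff_lt_colLen i j
    refine ⟨i, j, mem_iff_lt_rowLen.2 (by omega), ?_⟩
    unfold hookLength
    omega

/-- Between the bead `x` and the gap `x - (a + b)`, position `x - a` is either a gap for `x` or a
bead above that gap. -/
theorem exists_hookLength_eq_of_add (μ : YoungDiagram) {a b : ℕ} (ha : 0 < a) (hb : 0 < b)
    (h : ∃ i j : ℕ, (i, j) ∈ μ ∧ μ.hookLength i j = a + b) :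
    (∃ i j : ℕ, (i, j) ∈ μ ∧ μ.hookLength i j = a) ∨
      ∃ i j : ℕ, (i, j) ∈ μ ∧ μ.hookLength i j = b := by
  rw [exists_hookLength_eq_iff _ (by omega)] at h
  rw [exists_hookLength_eq_iff _ ha, exists_hookLength_eq_iff _ hb]
  obtain ⟨x, hx, hxab⟩ := h
  by_cases hxa : x - a ∈ μ.maya
  · refine Or.inr ⟨x - a, hxa, ?_⟩
    rwa [sub_sub, ← Nat.cast_add]
  · exact Or.inl ⟨x, hx, hxa⟩

theorem card_eq_sum_rowLen (μ : YoungDiagram) {N : ℕ} (hN : μ.colLen 0 ≤ N) :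
    μ.card = ∑ i ∈ Finset.range N, μ.rowLen i := by
  have hmaps : ∀ c ∈ μ.cells, c.1 ∈ Finset.range N := by
    rintro ⟨i, j⟩ hc
    have h1 := mem_iff_lt_colLen.1 ((mem_cells _).1 hc)
    have h2 := μ.colLen_anti 0 j (Nat.zero_le j)
    simp only [Finset.mem_range]
    omega
  rw [YoungDiagram.card, Finset.card_eq_sum_card_fiberwise hmaps]
  exact Finset.sum_congr rfl fun i _ => (μ.rowLen_eq_card).symm

/-- The bead positions of `μ` on an abacus with `N` beads. -/
def beads (μ : YoungDiagram) (N : ℕ) : Finset ℕ :=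
  (Finset.range N).image fun i => μ.rowLen i + (N - 1 - i)

theorem beads_injOn (μ : YoungDiagram) (N : ℕ) :
    Set.InjOn (fun i => μ.rowLen i + (N - 1 - i)) (Finset.range N : Set ℕ) := by
  intro i hi k hk h
  simp only [Finset.coe_range, Set.mem_Iio] at hi hk h
  rcases lt_trichotomy i k with hlt | heq | hlt
  · have := μ.rowLen_anti i k hlt.le
    omega
  · exact heq
  · have := μ.rowLen_anti k i hlt.le
    omega

theorem card_beads (μ : YoungDiagram) (N : ℕ) : (μ.beads N).card = N := by
  rw [beads, Finset.card_image_of_injOn (μ.beads_injOn N), Finset.card_range]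

theorem two_mul_sum_beads (μ : YoungDiagram) {N : ℕ} (hN : μ.colLen 0 ≤ N) :
    2 * ∑ x ∈ μ.beads N, x = 2 * μ.card + N * (N - 1) := by
  rw [beads, Finset.sum_image (μ.beads_injOn N), Finset.sum_add_distrib,
    ← μ.card_eq_sum_rowLen hN, Finset.sum_range_reflect (fun i => i) N,
    ← Finset.sum_range_id_mul_two]
  ring

theorem mem_beads_iff (μ : YoungDiagram) {N : ℕ} (hN : μ.colLen 0 ≤ N) (x : ℕ) :
    x ∈ μ.beads N ↔ (x : ℤ) - N ∈ μ.maya := by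
  simp only [beads, maya, Finset.mem_image, Finset.mem_range, Set.mem_range]
  constructor
  · rintro ⟨i, hi, rfl⟩
    exact ⟨i, by omega⟩
  · rintro ⟨i, hi⟩
    rcases lt_or_ge i N with h | h
    · exact ⟨i, h, by omega⟩
    · have := rowLen_eq_zero (hN.trans h)
      omega

theorem mem_maya_of_lt (μ : YoungDiagram) {N : ℕ} (hN : μ.colLen 0 ≤ N) {x : ℤ}
    (hx : x < -N) : x ∈ μ.maya :=
  ⟨(-1 - x).toNat, by dsimp only; rw [rowLen_eq_zero (by omega)]; omega⟩

end YoungDiagram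

/-! ### Bead sums on one runner and on two runners -/

namespace Finset

open Classical in
/-- A finite set of naturals is `range c`, possibly with the top element raised by one, as soon as
only gaps of size one occur in it. -/
theorem two_mul_sum_of_gap_le_one (S : Finset ℕ)
    (hS : ∀ x k : ℕ, 2 ≤ k → x + k ∈ S → x ∈ S) :
    2 * ∑ x ∈ S, (x : ℤ) = (S.card : ℤ) ^ 2 - S.card +
      2 * if ∃ x, x + 1 ∈ S ∧ x ∉ S then 1 else 0 := by
  have hrange (c : ℕ) : (2 * ∑ x ∈ range c, (x : ℤ)) = (c : ℤ) ^ 2 - c := by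
    induction c with
    | zero => simp
    | succ c ih => rw [sum_range_succ, mul_add, ih]; push_cast; ring
  split_ifs with h
  · obtain ⟨x, hx, hx'⟩ := h
    have hSeq : S = insert (x + 1) (range x) := by
      ext y
      simp only [mem_insert, mem_range]
      constructor
      · intro hy
        by_contra hcon
        rcases eq_or_ne y x with rfl | hne
        · exact hx' hy
        · exact hx' (hS x (y - x) (by omega) (by rwa [Nat.add_sub_cancel' (by omega)]))
      · rintro (rfl | hy)
        · exact hx
        · exact hS y (x + 1 - y) (by omega) (by rwa [Nat.add_sub_cancel' (by omega)])
    have hnot : x + 1 ∉ range x := by simp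
    rw [hSeq, sum_insert hnot, card_insert_of_notMem hnot, card_range, mul_add, hrange]
    push_cast
    ring
  · push Not at h
    have hstep (k x : ℕ) (hx : x + k ∈ S) : x ∈ S := by
      induction k with
      | zero => exact hx
      | succ k ih => exact ih (h _ hx)
    have hSeq : S = range S.card := by
      rcases S.eq_empty_or_nonempty with rfl | hne
      · simp
      · have : S = range (S.max' hne + 1) := by
          ext y
          rw [mem_range, Nat.lt_succ_iff]
          refine ⟨fun hy => S.le_max' y hy, fun hy => hstep (S.max' hne - y) y ?_⟩
          rw [Nat.add_sub_cancel' hy]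
          exact S.max'_mem hne
        conv_rhs => rw [this, card_range]
        exact this
    rw [mul_zero, add_zero, ← hrange S.card, ← hSeq]

theorem card_and_sum_of_parity_classes (X E O : Finset ℕ) (hE : ∀ y, y ∈ E ↔ 2 * y ∈ X)
    (hO : ∀ y, y ∈ O ↔ 2 * y + 1 ∈ X) :
    X.card = E.card + O.card ∧
      ∑ x ∈ X, x = 2 * ∑ y ∈ E, y + (2 * ∑ y ∈ O, y + O.card) := by
  have hEinj : Function.Injective fun y : ℕ => 2 * y := fun a b h => by
    dsimp only at h; omega
  have hOinj : Function.Injective fun y : ℕ => 2 * y + 1 := fun a b h => by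
    dsimp only at h; omega
  have hX : X = E.image (fun y => 2 * y) ∪ O.image (fun y => 2 * y + 1) := by
    ext x
    simp only [mem_union, mem_image, hE, hO]
    constructor
    · intro hx
      rcases Nat.even_or_odd' x with ⟨y, rfl | rfl⟩
      · exact Or.inl ⟨y, hx, rfl⟩
      · exact Or.inr ⟨y, hx, rfl⟩
    · rintro (⟨y, hy, rfl⟩ | ⟨y, hy, rfl⟩) <;> exact hy
  have hdisj : Disjoint (E.image fun y => 2 * y) (O.image fun y => 2 * y + 1) := by
    rw [disjoint_left]
    intro x hx hx'
    obtain ⟨a, -, rfl⟩ := mem_image.1 hx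
    obtain ⟨b, -, hb⟩ := mem_image.1 hx'
    omega
  constructor
  · rw [hX, card_union_of_disjoint hdisj, card_image_of_injective _ hEinj,
      card_image_of_injective _ hOinj]
  · rw [hX, sum_union hdisj, sum_image hEinj.injOn, sum_image hOinj.injOn, sum_add_distrib,
      ← mul_sum, ← mul_sum]
    simp

end Finset

/-! ### The size formula and conjugation -/

namespace YoungDiagram

/-- Some bead of parity `r` of the Maya diagram has a gap directly below it on its runner. -/
def HasParityGap (μ : YoungDiagram) (r : ℤ) : Prop :=
  ∃ y : ℤ, 2 * y + r + 2 ∈ μ.maya ∧ 2 * y + r ∉ μ.maya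

open Classical in
/-- The size of a diagram without even hooks other than `2`: a triangular number plus twice the
number of hooks of length `2`. -/
theorem two_mul_card_of_no_even_hook (μ : YoungDiagram)
    (hμ : ∀ k : ℕ, ¬ ∃ i j : ℕ, (i, j) ∈ μ ∧ μ.hookLength i j = 4 + k * 2) :
    ∃ d : ℤ, (2 * μ.card : ℤ) = d ^ 2 - d +
      4 * ((if μ.HasParityGap 0 then 1 else 0) + if μ.HasParityGap 1 then 1 else 0) := by
  set M := μ.colLen 0
  -- An even number of beads makes the shift from the Maya diagram to the abacus preserve parity.
  have hN : μ.colLen 0 ≤ 2 * M := by omega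
  set X := μ.beads (2 * M) with hX
  have hXmem (x : ℕ) : x ∈ X ↔ (x : ℤ) - 2 * M ∈ μ.maya := by
    rw [hX, μ.mem_beads_iff hN]; push_cast; rfl
  have hgap (x k : ℕ) (hk : 2 ≤ k) (hx : x + 2 * k ∈ X) : x ∈ X := by
    by_contra hx'
    refine hμ (k - 2) ((μ.exists_hookLength_eq_iff (by omega)).2
      ⟨_, (hXmem _).1 hx, fun hmem => hx' ((hXmem x).2 ?_)⟩)
    convert hmem using 1
    push_cast [Nat.cast_sub hk]
    ring
  have hclass (r : ℕ) (S : Finset ℕ) (hS : ∀ y, y ∈ S ↔ 2 * y + r ∈ X) (hr : r ≤ 1) :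
      2 * ∑ x ∈ S, (x : ℤ) = (S.card : ℤ) ^ 2 - S.card +
        2 * if μ.HasParityGap r then 1 else 0 := by
    rw [S.two_mul_sum_of_gap_le_one]
    · congr 2
      refine if_congr ?_ rfl rfl
      simp only [hS, hXmem, HasParityGap]
      constructor
      · rintro ⟨x, h1, h2⟩
        refine ⟨x - M, ?_, ?_⟩
        · convert h1 using 1; push_cast; ring
        · convert h2 using 2; push_cast; ring
      · rintro ⟨y, h1, h2⟩
        have hy : ¬ 2 * y + r < -(2 * M : ℕ) := fun h => h2 (μ.mem_maya_of_lt hN h)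
        obtain ⟨x, hx⟩ := Int.eq_ofNat_of_zero_le (show 0 ≤ y + M by omega)
        obtain rfl : y = x - M := by omega
        refine ⟨x, ?_, ?_⟩
        · convert h1 using 1; push_cast; ring
        · convert h2 using 2; push_cast; ring
    · intro x k hk hx
      rw [hS] at hx ⊢
      exact hgap _ k hk (by convert hx using 1; ring)
  set E := X.preimage (fun y => 2 * y) (Function.Injective.injOn fun a b h => by omega) with hEdef
  set O := X.preimage (fun y => 2 * y + 1) (Function.Injective.injOn fun a b h => by omega) with hOdef
  have hE (y : ℕ) : y ∈ E ↔ 2 * y ∈ X := by rw [hEdef, Finset.mem_preimage]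
  have hO (y : ℕ) : y ∈ O ↔ 2 * y + 1 ∈ X := by rw [hOdef, Finset.mem_preimage]
  obtain ⟨hcard, hsum⟩ := X.card_and_sum_of_parity_classes E O hE hO
  have h0 := hclass 0 E (by simpa using hE) (by omega)
  have h1 := hclass 1 O (by simpa using hO) le_rfl
  rw [Nat.cast_zero] at h0
  rw [Nat.cast_one] at h1
  have htot := μ.two_mul_sum_beads hN
  have hcard' : E.card + O.card = 2 * M := by rw [← hcard, hX, card_beads]
  rw [← hX, hsum, ← hcard'] at htot
  have htot' : (2 * (2 * ∑ y ∈ E, (y : ℤ) + (2 * ∑ y ∈ O, (y : ℤ) + O.card))) =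
      2 * μ.card + ((E.card : ℤ) + O.card) * ((E.card : ℤ) + O.card - 1) := by
    -- The empty abacus is separate because `N - 1` is truncated there.
    rcases Nat.eq_zero_or_pos (E.card + O.card) with hz | hpos
    · have := congrArg (Nat.cast : ℕ → ℤ) htot
      rw [hz] at this
      have hz' : ((E.card : ℤ) + O.card) = 0 := by exact_mod_cast hz
      rw [hz', zero_mul]
      push_cast at this
      linarith
    · have := congrArg (Nat.cast : ℕ → ℤ) htot
      push_cast [Nat.cast_sub (show 1 ≤ E.card + O.card from hpos)] at this
      linarith
  refine ⟨(E.card : ℤ) - O.card, ?_⟩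
  rw [h0, h1] at htot'
  linear_combination -htot'

/-- The reflection `z ↦ -1 - z` flips parity and exchanges beads with gaps. -/
theorem hasParityGap_one_transpose (μ : YoungDiagram) :
    μ.transpose.HasParityGap 1 ↔ μ.HasParityGap 0 := by
  simp only [HasParityGap, mem_maya_transpose, not_not]
  constructor
  · rintro ⟨y, h1, h2⟩
    refine ⟨-y - 2, ?_, ?_⟩
    · convert h2 using 1; ring
    · convert h1 using 2; ring
  · rintro ⟨y, h1, h2⟩
    refine ⟨-y - 2, ?_, ?_⟩
    · convert h2 using 2; ring
    · convert h1 using 1; ring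

theorem hookLength_transpose (μ : YoungDiagram) (i j : ℕ) :
    μ.transpose.hookLength i j = μ.hookLength j i := by
  simp only [hookLength, rowLen_transpose, colLen_transpose]
  omega

theorem exists_hookLength_transpose (μ : YoungDiagram) (h : ℕ) :
    (∃ i j : ℕ, (i, j) ∈ μ.transpose ∧ μ.transpose.hookLength i j = h) ↔
      ∃ i j : ℕ, (i, j) ∈ μ ∧ μ.hookLength i j = h := by
  simp only [hookLength_transpose, mem_transpose, Prod.swap_prod_mk]
  exact exists_comm

theorem card_transpose (μ : YoungDiagram) : μ.transpose.card = μ.card :=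
  Finset.card_map _

theorem sum_rowLens (μ : YoungDiagram) : μ.rowLens.sum = μ.card := by
  rw [μ.card_eq_sum_rowLen le_rfl, rowLens, Finset.sum, Finset.range_val, Multiset.range,
    Multiset.map_coe, Multiset.sum_coe]

/-- The partition whose parts are the row lengths of a Young diagram. -/
def toPartition (μ : YoungDiagram) {n : ℕ} (hμ : μ.card = n) : n.Partition where
  parts := (μ.rowLens : Multiset ℕ)
  parts_pos h := μ.pos_of_mem_rowLens _ h
  parts_sum := by rw [Multiset.sum_coe, sum_rowLens, hμ]

theorem youngDiagram_toPartition (μ : YoungDiagram) {n : ℕ} (hμ : μ.card = n) :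
    (μ.toPartition hμ).youngDiagram = μ := by
  have h : (μ.toPartition hμ).parts.sort (· ≥ ·) = μ.rowLens := by
    refine List.Perm.eq_of_pairwise' (Multiset.pairwise_sort _ _) μ.rowLens_sorted.pairwise ?_
    rw [← Multiset.coe_eq_coe, Multiset.sort_eq]
    rfl
  conv_rhs => rw [← ofRowLens_to_rowLens_eq_self (μ := μ)]
  unfold Nat.Partition.youngDiagram
  congr 1

end YoungDiagram

/-! ### Partitions, conjugation and residues modulo 11 -/

namespace Nat.Partition

theorem rowLens_youngDiagram {n : ℕ} (p : n.Partition) :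
    p.youngDiagram.rowLens = p.parts.sort (· ≥ ·) :=
  YoungDiagram.rowLens_ofRowLens_eq_self fun _ hx => p.parts_pos ((Multiset.mem_sort _).1 hx)

theorem youngDiagram_injective {n : ℕ} :
    Function.Injective (youngDiagram : n.Partition → YoungDiagram) := by
  intro p q h
  ext1
  rw [← Multiset.sort_eq p.parts (· ≥ ·), ← Multiset.sort_eq q.parts (· ≥ ·),
    ← rowLens_youngDiagram, ← rowLens_youngDiagram, h]

theorem card_youngDiagram {n : ℕ} (p : n.Partition) : p.youngDiagram.card = n := by
  rw [← YoungDiagram.sum_rowLens, rowLens_youngDiagram, ← Multiset.sum_coe, Multiset.sort_eq,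
    p.parts_sum]

/-- The conjugate partition. -/
def conj {n : ℕ} (p : n.Partition) : n.Partition :=
  p.youngDiagram.transpose.toPartition (by rw [YoungDiagram.card_transpose, card_youngDiagram])

theorem youngDiagram_conj {n : ℕ} (p : n.Partition) :
    p.conj.youngDiagram = p.youngDiagram.transpose :=
  YoungDiagram.youngDiagram_toPartition _ _

theorem conj_conj {n : ℕ} (p : n.Partition) : p.conj.conj = p :=
  youngDiagram_injective <| by
    rw [youngDiagram_conj, youngDiagram_conj, YoungDiagram.transpose_transpose]

theorem hasHook_conj {n : ℕ} (p : n.Partition) (h : ℕ) : p.conj.HasHook h ↔ p.HasHook h := by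
  rw [HasHook, youngDiagram_conj, YoungDiagram.exists_hookLength_transpose, HasHook]

theorem IsModCore.conj {n s t : ℕ} {p : n.Partition} (hp : p.IsModCore s t) :
    p.conj.IsModCore s t :=
  fun k => by rw [hasHook_conj]; exact hp k

/-- 4 and 6 generate every even number from 4 on, and a hook of length `a + b` yields one of length
`a` or `b`. -/
theorem isModCore_four_two_iff {n : ℕ} (p : n.Partition) :
    p.IsModCore 4 2 ↔ p.IsCore 4 ∧ p.IsCore 6 := by
  refine ⟨fun h => ⟨h 0, h 1⟩, fun ⟨h4, h6⟩ k => ?_⟩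
  induction k using Nat.strong_induction_on with
  | _ k ih =>
    match k with
    | 0 => exact h4
    | 1 => exact h6
    | k + 2 =>
      intro h
      rw [show 4 + (k + 2) * 2 = 4 + (4 + k * 2) by ring] at h
      rcases p.youngDiagram.exists_hookLength_eq_of_add (by omega) (by omega) h with h | h
      · exact h4 h
      · exact ih k (by omega) h

open Classical in
theorem IsModCore.two_mul_eq {n : ℕ} {p : n.Partition} (hp : p.IsModCore 4 2) :
    ∃ d : ℤ, (2 * n : ℤ) = d ^ 2 - d + 4 * ((if p.youngDiagram.HasParityGap 0 then 1 else 0) +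
      if p.youngDiagram.HasParityGap 1 then 1 else 0) := by
  simpa only [card_youngDiagram] using p.youngDiagram.two_mul_card_of_no_even_hook hp

/-- Here `(2d - 1)² = 8n + 1 - 16e` would be 7, 2 or 8 modulo 11, all nonresidues. -/
theorem IsModCore.mod_eleven_ne_nine {n : ℕ} {p : n.Partition} (hp : p.IsModCore 4 2) :
    n % 11 ≠ 9 := by
  intro hn
  obtain ⟨d, hd⟩ := hp.two_mul_eq
  obtain ⟨j, rfl⟩ : ∃ j, n = 11 * j + 9 := ⟨n / 11, by omega⟩
  have h := congrArg (Int.cast : ℤ → ZMod 11) hd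
  have h11 : (11 : ZMod 11) = 0 := rfl
  push_cast at h
  rw [h11, zero_mul, zero_add] at h
  generalize (d : ZMod 11) = x at h
  revert x
  split_ifs <;> decide

/-- Self-conjugacy makes the runners agree, so `e` is 0 or 2 and `(2d - 1)²` would be the nonresidue
6 or 7. -/
theorem IsModCore.conj_ne_self {n : ℕ} {p : n.Partition} (hp : p.IsModCore 4 2)
    (hn : n % 11 = 2) : p.conj ≠ p := by
  intro hself
  obtain ⟨d, hd⟩ := hp.two_mul_eq
  have hgap : p.youngDiagram.HasParityGap 1 ↔ p.youngDiagram.HasParityGap 0 := by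
    conv_lhs => rw [← hself, youngDiagram_conj, YoungDiagram.hasParityGap_one_transpose]
  rw [show p.youngDiagram.HasParityGap 1 = p.youngDiagram.HasParityGap 0 from propext hgap] at hd
  obtain ⟨j, rfl⟩ : ∃ j, n = 11 * j + 2 := ⟨n / 11, by omega⟩
  have h := congrArg (Int.cast : ℤ → ZMod 11) hd
  have h11 : (11 : ZMod 11) = 0 := rfl
  push_cast at h
  rw [h11, zero_mul, zero_add] at h
  generalize (d : ZMod 11) = x at h
  revert x
  split_ifs <;> decide

end Nat.Partition

theorem Fintype.even_card_of_fixedPointFree_involutive {α : Type*} [Fintype α] {f : α → α}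
    (hf : Function.Involutive f) (hne : ∀ a, f a ≠ a) : Even (Fintype.card α) := by
  have h : ∑ _a : α, (1 : ZMod 2) = 0 :=
    Finset.sum_involution (fun a _ => f a) (fun _ _ => by decide) (fun a _ _ => hne a)
      (fun _ _ => Finset.mem_univ _) (fun a _ => hf a)
  rw [Finset.sum_const, nsmul_one, Finset.card_univ, ZMod.natCast_eq_zero_iff] at h
  exact even_iff_two_dvd.2 h

theorem mainTheorem10 :
    (∀ (n : ℕ) (p : n.Partition), p.IsModCore 4 2 ↔ p.IsCore 4 ∧ p.IsCore 6) ∧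
    (∀ j : ℕ, numModCores 4 2 (11 * j + 9) = 0) ∧
    (∀ j : ℕ, numModCores 4 2 (11 * j + 2) ≡ 0 [MOD 2]) := by
  refine ⟨fun n p => p.isModCore_four_two_iff, fun j => ?_, fun j => ?_⟩
  · have : IsEmpty {p : (11 * j + 9).Partition // p.IsModCore 4 2} :=
      ⟨fun p => p.2.mod_eleven_ne_nine (by omega)⟩
    exact Nat.card_of_isEmpty
  · classical
    rw [Nat.modEq_zero_iff_dvd, ← even_iff_two_dvd, numModCores, Nat.card_eq_fintype_card]
    exact Fintype.even_card_of_fixedPointFree_involutive (f := fun p => ⟨p.1.conj, p.2.conj⟩)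
      (fun p => Subtype.ext p.1.conj_conj)
      (fun p h => p.2.conj_ne_self (by omega) (congrArg Subtype.val h))
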